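/- Let $n\ge 2$ and let $\mathcal M^n$ be one of $\mathbb R^n$, the unit sphere $S^n\subset\mathbb R^{n+1}$, or hyperbolic space $H^n$ (of curvature $-1$), with geodesic distance $d$ and closed balls $B(x,r)=\{y\in\mathcal M^n : d(x,y)\le r\}$. For $X\subset\mathcal M^n$ let $\operatorname{diam}X=\sup_{x,y\in X}d(x,y)$. Call $X$ convex if it contains the shortest geodesic segment between any two of its points and, when $\mathcal M^n=S^n$, is contained in an open hemisphere; a convex body is a compact convex set with non-empty interior. An outer unit normal of a convex body $K$ at $p\in\partial K$ is a unit vector $v\in T_p\mathcal M^n$ that is the exterior normal at $p$ of a closed half-space containing $K$ and having $p$ on its boundary. Let $D>0$, with $D<\frac{\pi}{2}$ if $\mathcal M^n=S^n$, and let $K\subset\mathcal M^n$ be a compact set with $\operatorname{diam}K=D$. Then the following are equivalent: (i) $K$ is of constant width $D$ in the sense of Dekster, i.e. $K$ is a convex body with $\operatorname{diam}K=D$, and for every $p\in\partial K$ and every outer unit normal $v\in T_p\mathcal M^n$ of $K$ at $p$, the geodesic segment of length $D$ starting at $p$ in direction $-v$ is contained in $K$; (ii) $K$ is complete, i.e.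 $\operatorname{diam}(K\cup\{y\})>\operatorname{diam}K$ for every $y\in\mathcal M^n\setminus K$; (iii) $K=\bigcap_{x\in K}B(x,D)$. -/

import Mathlib

open scoped ENNReal RealInnerProductSpace

noncomputable section

/-- The three families of spaces of constant curvature: `ℝⁿ`, `Sⁿ` and `Hⁿ`. -/
inductive SpaceForm where
  | euclidean
  | spherical
  | hyperbolic

namespace SpaceForm

/-- The dimension of the linear space containing the model: `ℝⁿ` is its own model, `Sⁿ` is the
unit sphere of `ℝⁿ⁺¹`, and `Hⁿ` is the upper sheet of a hyperboloid in `ℝⁿ⁺¹`. -/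
def ambientDim : SpaceForm → ℕ → ℕ
  | euclidean, n => n
  | spherical, n => n + 1
  | hyperbolic, n => n + 1

/-- The linear space containing the model. -/
abbrev Ambient (M : SpaceForm) (n : ℕ) : Type := EuclideanSpace ℝ (Fin (M.ambientDim n))

/-- The Lorentzian form `t s - ⟨x₀, y₀⟩` of `x = (t, x₀)` and `y = (s, y₀)` in `ℝ × ℝⁿ = ℝⁿ⁺¹`. -/
def lorentz {n : ℕ} (x y : EuclideanSpace ℝ (Fin (n + 1))) : ℝ :=
  x 0 * y 0 - ∑ i : Fin n, x i.succ * y i.succ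

/-- The underlying set of the model. -/
def carrier : (M : SpaceForm) → (n : ℕ) → Set (M.Ambient n)
  | euclidean, _ => Set.univ
  | spherical, _ => {x | ⟪x, x⟫ = 1}
  | hyperbolic, n => {x : EuclideanSpace ℝ (Fin (n + 1)) | 1 ≤ x 0 ∧ lorentz x x = 1}

/-- The points of the model, with the subspace topology. -/
abbrev Point (M : SpaceForm) (n : ℕ) : Type := M.carrier n

variable {n : ℕ}

/-- The geodesic distance, written on the ambient vectors of the points. -/
def ambientDist : (M : SpaceForm) → M.Ambient n → M.Ambient n → ℝ
  | euclidean, x, y => dist x y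
  | spherical, x, y => 2 * Real.arcsin (dist x y / 2)
  | hyperbolic, x, y => Real.arcosh (lorentz (n := n) x y)

/-- The geodesic distance of two points. -/
def gdist (M : SpaceForm) (x y : M.Point n) : ℝ := M.ambientDist x.1 y.1

/-- The tangent space `T_z` at the point `z`, as a set of vectors of the ambient space. -/
def tangent : (M : SpaceForm) → M.Ambient n → Set (M.Ambient n)
  | euclidean, _ => Set.univ
  | spherical, z => {u | ⟪u, z⟫ = 0}
  | hyperbolic, z => {u | lorentz (n := n) u z = 0}

/-- The bilinear form on the ambient space whose restriction to each tangent space is the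
Riemannian scalar product. -/
def form : (M : SpaceForm) → M.Ambient n → M.Ambient n → ℝ
  | euclidean, u, v => ⟪u, v⟫
  | spherical, u, v => ⟪u, v⟫
  | hyperbolic, u, v => -lorentz (n := n) u v

/-- The set of unit tangent vectors at `z`. -/
def unitTangent (M : SpaceForm) (z : M.Ambient n) : Set (M.Ambient n) :=
  {u | u ∈ M.tangent z ∧ M.form u u = 1}

/-- The unit speed geodesic line `t ↦ p_t` through `z` with initial direction `u`. -/
def geodesic : (M : SpaceForm) → M.Ambient n → M.Ambient n → ℝ → M.Ambient n
  | euclidean, z, u, t => z + t • u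
  | spherical, z, u, t => Real.cos t • z + Real.sin t • u
  | hyperbolic, z, u, t => Real.cosh t • z + Real.sinh t • u

/-- The geodesic segment of length `t` starting at `z` in the direction `u`. -/
def segmentAlong (M : SpaceForm) (z u : M.Ambient n) (t : ℝ) : Set (M.Ambient n) :=
  M.geodesic z u '' Set.Icc 0 t

/-- In the spherical case, `X` lies in an open hemisphere; no condition otherwise. -/
def HemisphereCondition (M : SpaceForm) (X : Set (M.Point n)) : Prop :=
  M = spherical → ∃ e : M.Ambient n, ⟪e, e⟫ = 1 ∧ ∀ x ∈ X, 0 < ⟪x.1, e⟫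

/-- Geodesic convexity: with any two points `x, y` the set `X` contains the geodesic segment of
length `d(x, y)` from `x` to `y`; in the spherical case `X` also lies in an open hemisphere
(so that no two points of `X` are antipodal). -/
def IsConvex (M : SpaceForm) (X : Set (M.Point n)) : Prop :=
  M.HemisphereCondition X ∧
    ∀ x ∈ X, ∀ y ∈ X, ∀ u ∈ M.unitTangent x.1, M.geodesic x.1 u (M.gdist x y) = y.1 →
      M.segmentAlong x.1 u (M.gdist x y) ⊆ Subtype.val '' X

/-- A convex body: compact, convex, with non-empty interior. -/
def IsConvexBody (M : SpaceForm) (K : Set (M.Point n)) : Prop :=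
  IsCompact K ∧ M.IsConvex K ∧ (interior K).Nonempty

/-- The diameter, the supremum of the geodesic distances of pairs of points (in `[0, ∞]`). -/
def diam (M : SpaceForm) (X : Set (M.Point n)) : ℝ≥0∞ :=
  ⨆ x ∈ X, ⨆ y ∈ X, ENNReal.ofReal (M.gdist x y)

/-- The closed ball of centre `z` and radius `r`. -/
def ball (M : SpaceForm) (z : M.Point n) (r : ℝ) : Set (M.Point n) := {x | M.gdist x z ≤ r}

/-- The closed half-space whose boundary hyperplane passes through `z` and whose exterior normal
at `z` is `v`, where `v` is tangent at `z`. -/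
def halfSpace : (M : SpaceForm) → M.Ambient n → M.Ambient n → Set (M.Point n)
  | euclidean, z, v => {x | ⟪x.1, v⟫ ≤ ⟪z, v⟫}
  | spherical, _, v => {x | ⟪x.1, v⟫ ≤ 0}
  | hyperbolic, _, v => {x | -lorentz (n := n) x.1 v ≤ 0}

/-- `v` is an outer unit normal of `K` at `p`: `v` is the exterior unit normal at `p` of a
half-space that contains `K` and has `p` on its boundary. -/
def IsOuterUnitNormal (M : SpaceForm) (K : Set (M.Point n)) (p : M.Point n) (v : M.Ambient n) :
    Prop :=
  v ∈ M.unitTangent p.1 ∧ K ⊆ M.halfSpace p.1 v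

/-- Constant width `D` in the sense of Dekster: a convex body of diameter `D` such that for every
boundary point `p` and every outer unit normal `v` at `p`, the geodesic segment of length `D`
starting at `p` in the direction `-v` is contained in `K`. (Meant for `D > 0`, and for `D < π / 2`
in the spherical case.) -/
def IsConstantWidth (M : SpaceForm) (K : Set (M.Point n)) (D : ℝ) : Prop :=
  M.IsConvexBody K ∧ M.diam K = ENNReal.ofReal D ∧
    ∀ p ∈ frontier K, ∀ v, M.IsOuterUnitNormal K p v →
      M.segmentAlong p.1 (-v) D ⊆ Subtype.val '' K

/-- Completeness in the sense of diameters: adding any new point increases the diameter. -/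
def IsDiamComplete (M : SpaceForm) (K : Set (M.Point n)) : Prop :=
  ∀ y, y ∉ K → M.diam K < M.diam (K ∪ {y})

end SpaceForm

end

noncomputable section

open Filter Topology

/-! Since `K` has diameter `D`, it lies in the intersection of the balls. So (iii) only says that a
point `y` within `D` of all of `K` belongs to `K`. Such a `y` outside `K` is exactly a point that
can be added without increasing the diameter, and this settles (ii) ⇔ (iii).

(i) ⇒ (iii): let `y ∉ K` be within `D` of all of `K`, let `p` be a nearest point of `K` and `v` the
direction from `p` to `y`. By convexity and first variation (`geodesicPoint_mem_halfSpace`), `v` is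
an outer normal at `p`. Constant width puts in `K` the point at distance `D` from `p` in direction
`-v`. As `p` lies between it and `y`, it is farther than `D` from `y`
(`lt_gdist_geodesicPoint_neg`), a contradiction.

(iii) ⇒ (i): balls of radius `D` are convex (`gdist_geodesicPoint_le`), hence so is `K`. The
midpoint of two distinct points of `K` is at distance less than `D` from all of `K`
(`exists_forall_gdist_lt`), so it is interior. For the width condition, let `q` be the point
opposite to `p` along `-v`. If some `z ∈ K` had `d(q, z) > D`, then moving `p` slightly towards `z`
and along `v` would give a `y` strictly beyond the supporting hyperplane with `B(p, D) ∩ B(z, D) ⊆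
B(y, D)`. Then `y ∈ K`, which is impossible. So `q` is within `D` of all of `K`, that is, `q ∈ K`.
The perturbation is carried out by `exists_inner_lt_of_lt_dist`, `exists_inner_pos_of_inner_lt` and
`exists_lorentz_neg_of_lt_lorentz`. -/

/-- A function that is maximal at the left end point of an interval has non-positive derivative
there. -/
theorem HasDerivAt.nonpos_of_forall_Icc_le {f : ℝ → ℝ} {a b : ℝ} (hf : HasDerivAt f b 0)
    (ha : 0 < a) (h : ∀ t ∈ Set.Icc 0 a, f t ≤ f 0) : b ≤ 0 := by
  have h1 := (hasDerivAt_iff_tendsto_slope.1 hf).mono_left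
    (nhdsWithin_mono (0 : ℝ) (fun x (hx : x ∈ Set.Ioi (0 : ℝ)) => ne_of_gt hx))
  refine le_of_tendsto h1 ?_
  filter_upwards [Ioo_mem_nhdsGT ha] with t ht
  rw [slope_def_field]
  have := h t ⟨ht.1.le, ht.2.le⟩
  exact div_nonpos_of_nonpos_of_nonneg (by linarith) (by linarith [ht.1])

/-- The perturbations need several smallness conditions on `ε`, with coefficients of unknown sign;
as eventual statements they can be met simultaneously. -/
theorem eventually_mul_lt_nhdsGT_zero (R : ℝ) {A : ℝ} (hA : 0 < A) :
    ∀ᶠ ε in 𝓝[>] (0 : ℝ), ε * R < A := by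
  have : Tendsto (fun ε : ℝ => ε * R) (𝓝 0) (𝓝 (0 * R)) := tendsto_id.mul_const R
  rw [zero_mul] at this
  exact (this.mono_left nhdsWithin_le_nhds).eventually (gt_mem_nhds hA)

/-! ### Linear algebra of the unit sphere -/

section Sphere

variable {E : Type*} [NormedAddCommGroup E] [InnerProductSpace ℝ E]

theorem two_mul_arcsin_half_dist {x y : E} (hx : ⟪x, x⟫ = 1) (hy : ⟪y, y⟫ = 1) :
    2 * Real.arcsin (dist x y / 2) = Real.arccos ⟪x, y⟫ := by
  have hx' : ‖x‖ = 1 := by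
    rw [real_inner_self_eq_norm_sq] at hx
    nlinarith [norm_nonneg x]
  have hy' : ‖y‖ = 1 := by
    rw [real_inner_self_eq_norm_sq] at hy
    nlinarith [norm_nonneg y]
  have h2 : dist x y ≤ 2 := by
    rw [dist_eq_norm]
    linarith [norm_sub_le x y]
  have h0 := dist_nonneg (x := x) (y := y)
  have hsq : dist x y ^ 2 = 2 - 2 * ⟪x, y⟫ := by
    rw [dist_eq_norm, norm_sub_sq_real, hx', hy']
    ring
  have hcos : Real.cos (2 * Real.arcsin (dist x y / 2)) = ⟪x, y⟫ := by
    rw [Real.cos_two_mul, Real.cos_sq', Real.sin_arcsin (by linarith) (by linarith)]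
    linarith
  rw [← hcos, Real.arccos_cos]
  · linarith [Real.arcsin_nonneg.2 (by linarith : 0 ≤ dist x y / 2)]
  · linarith [Real.arcsin_le_pi_div_two (dist x y / 2)]

/-- Bessel's inequality for the orthonormal pair `p, v`: the remaining component of `x` has
non-negative square norm. -/
theorem inner_sq_add_inner_sq_le {p v x : E} (hp : ⟪p, p⟫ = 1) (hv : ⟪v, v⟫ = 1)
    (hvp : ⟪v, p⟫ = 0) (hx : ⟪x, x⟫ = 1) : ⟪p, x⟫ ^ 2 + ⟪v, x⟫ ^ 2 ≤ 1 := by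
  have h := real_inner_self_nonneg (x := x - ⟪p, x⟫ • p - ⟪v, x⟫ • v)
  simp only [inner_sub_left, inner_sub_right, inner_smul_left, inner_smul_right,
    real_inner_comm p v, real_inner_comm p x, real_inner_comm v x, hp, hv, hx,
    RCLike.conj_to_real] at h
  simp only [real_inner_comm v p, hvp, real_inner_comm x p, real_inner_comm x v] at h ⊢
  nlinarith

/-- If `z` is too far from the point at distance `D` from `p` in direction `-v` (with
`cos D = c`, `sin D = s`), then every ball of radius `D` containing `p` and `z` contains a
fixed point beyond the hyperplane orthogonal to `v`. -/
theorem exists_inner_pos_of_inner_lt {p z v : E} (hp : ⟪p, p⟫ = 1) (hz : ⟪z, z⟫ = 1)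
    (hv : ⟪v, v⟫ = 1) (hvp : ⟪v, p⟫ = 0) {c s : ℝ} (hc : 0 < c) (hs : 0 < s)
    (hcs : c ^ 2 + s ^ 2 = 1) (h : c * ⟪p, z⟫ - s * ⟪v, z⟫ < c) :
    ∃ y : E, ⟪y, y⟫ = 1 ∧ 0 < ⟪y, v⟫ ∧
      ∀ x : E, ⟪x, x⟫ = 1 → c ≤ ⟪p, x⟫ → c ≤ ⟪z, x⟫ → c ≤ ⟪y, x⟫ := by
  have hαβ := inner_sq_add_inner_sq_le hp hv hvp hz
  have hα : ⟪p, z⟫ < 1 := by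
    by_contra! h1
    have h2 : ⟪v, z⟫ ^ 2 ≤ 0 := by nlinarith
    have h3 : ⟪v, z⟫ = 0 := by nlinarith
    rw [h3] at h
    nlinarith
  -- The lower bound on `μ` puts the perturbed point strictly beyond the hyperplane; the upper bound
  -- keeps it close enough to every `x`. Hypothesis `h` is what makes room between the two.
  obtain ⟨μ, hμ1, hμ2⟩ : ∃ μ, max 0 (-⟪v, z⟫) < μ ∧ μ < c * (1 - ⟪p, z⟫) / s := by
    refine exists_between (max_lt ?_ ?_)
    · have : 0 < 1 - ⟪p, z⟫ := by linarith
      positivity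
    · rw [lt_div_iff₀ hs]
      linarith
  have hμ0 : 0 < μ := (le_max_left _ _).trans_lt hμ1
  have hμβ : 0 < ⟪v, z⟫ + μ := by linarith [(le_max_right _ _).trans_lt hμ1]
  rw [lt_div_iff₀ hs] at hμ2
  -- `R` is the square norm of `z - p + μ • v`, the direction in which `p` is moved.
  set R : ℝ := 2 - 2 * ⟪p, z⟫ + 2 * μ * ⟪v, z⟫ + μ ^ 2 with hR
  obtain ⟨ε, ⟨⟨hε, hε1⟩, hε2⟩, hε3⟩ := ((((eventually_mem_nhdsWithin (a := (0 : ℝ))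
    (s := Set.Ioi 0)).and (eventually_mul_lt_nhdsGT_zero 1 one_pos)).and
    (eventually_mul_lt_nhdsGT_zero (μ * s) hc)).and
    (eventually_mul_lt_nhdsGT_zero (c ^ 2 * R - μ ^ 2 * s ^ 2)
      (by nlinarith : 0 < 2 * c * (c * (1 - ⟪p, z⟫) - μ * s)))).exists
  have hε : 0 < ε := hε
  set Y : E := (1 - ε) • p + ε • z + (ε * μ) • v with hY
  have hYx : ∀ x, ⟪Y, x⟫ = (1 - ε) * ⟪p, x⟫ + ε * ⟪z, x⟫ + ε * μ * ⟪v, x⟫ := fun x => by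
    simp [hY, inner_add_left, real_inner_smul_left]
  have hYv : 0 < ⟪Y, v⟫ := by
    rw [hYx, hv, real_inner_comm, hvp, real_inner_comm v z]
    nlinarith [mul_pos hε hμβ]
  have hY0 : 0 < ‖Y‖ := norm_pos_iff.2 fun h0 => by simp [h0] at hYv
  have hYY : ‖Y‖ ^ 2 = 1 - 2 * ε * (1 - ⟪p, z⟫) + ε ^ 2 * R := by
    rw [← real_inner_self_eq_norm_sq, hYx, real_inner_comm Y p, real_inner_comm Y z,
      real_inner_comm Y v, hYx, hYx, hYx, hp, hz, hv, hvp, real_inner_comm v p, hvp,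
      real_inner_comm p z, real_inner_comm v z, hR]
    ring
  -- To first order in `ε`, the norm falls by `ε * (1 - ⟪p, z⟫)`, which compensates the possible
  -- loss `ε * (μ * s)` in `⟪Y, x⟫`.
  have hle : c * ‖Y‖ ≤ c - ε * (μ * s) := by
    refine abs_le_of_sq_le_sq' ?_ (by linarith) |>.2
    rw [mul_pow, hYY]
    nlinarith [mul_lt_mul_of_pos_left hε3 hε]
  refine ⟨‖Y‖⁻¹ • Y, ?_, ?_, fun x hx hpx hzx => ?_⟩
  · rw [real_inner_smul_left, real_inner_smul_right, real_inner_self_eq_norm_sq]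
    field_simp
  · rw [real_inner_smul_left]
    positivity
  · rw [real_inner_smul_left, inv_mul_eq_div, le_div_iff₀ hY0]
    refine hle.trans ?_
    rw [hYx]
    have h1 := inner_sq_add_inner_sq_le hp hv hvp hx
    have h2 : -s ≤ ⟪v, x⟫ := by
      refine (abs_le_of_sq_le_sq' (a := ⟪v, x⟫) (b := s) ?_ hs.le).1
      linarith [pow_le_pow_left₀ hc.le hpx 2]
    linarith [mul_le_mul_of_nonneg_left hpx (by linarith : 0 ≤ 1 - ε),
      mul_le_mul_of_nonneg_left hzx hε.le, mul_le_mul_of_nonneg_left h2 (mul_pos hε hμ0).le]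

end Sphere

/-! ### Linear algebra of the Lorentzian form -/

namespace SpaceForm
section Lorentz
variable {n : ℕ}

local notation "E" => EuclideanSpace ℝ (Fin (n + 1))

theorem lorentz_comm (x y : E) : lorentz x y = lorentz y x := by
  simp [lorentz, mul_comm]

theorem lorentz_add_left (x y z : E) : lorentz (x + y) z = lorentz x z + lorentz y z := by
  simp only [lorentz, PiLp.add_apply, add_mul, Finset.sum_add_distrib]
  ring

theorem lorentz_smul_left (a : ℝ) (x z : E) : lorentz (a • x) z = a * lorentz x z := by
  simp only [lorentz, PiLp.smul_apply, smul_eq_mul, mul_sub, Finset.mul_sum, mul_assoc]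

theorem lorentz_neg_left (x z : E) : lorentz (-x) z = -lorentz x z := by
  rw [← neg_one_smul ℝ, lorentz_smul_left, neg_one_mul]

theorem lorentz_add_right (x y z : E) : lorentz x (y + z) = lorentz x y + lorentz x z := by
  rw [lorentz_comm, lorentz_add_left, lorentz_comm y, lorentz_comm z]

theorem lorentz_smul_right (a : ℝ) (x z : E) : lorentz x (a • z) = a * lorentz x z := by
  rw [lorentz_comm, lorentz_smul_left, lorentz_comm z]

theorem lorentz_neg_right (x z : E) : lorentz x (-z) = -lorentz x z := by
  rw [lorentz_comm, lorentz_neg_left, lorentz_comm z]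

theorem continuous_lorentz : Continuous fun xy : E × E => lorentz xy.1 xy.2 := by
  unfold lorentz
  fun_prop

/-- The vectors orthogonal to a timelike vector are spacelike. -/
theorem lorentz_self_nonpos {p v : E} (hp : lorentz p p = 1) (hpv : lorentz v p = 0) :
    lorentz v v ≤ 0 ∧ (lorentz v v = 0 → v = 0) := by
  have hcs := Finset.sum_mul_sq_le_sq_mul_sq Finset.univ
    (fun i : Fin n => v i.succ) (fun i : Fin n => p i.succ)
  have hs : 0 ≤ ∑ i : Fin n, v i.succ ^ 2 := Finset.sum_nonneg fun i _ => sq_nonneg _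
  have hs' : 0 ≤ ∑ i : Fin n, p i.succ ^ 2 := Finset.sum_nonneg fun i _ => sq_nonneg _
  simp only [lorentz, ← sq] at *
  have h1 : (∑ i : Fin n, p i.succ ^ 2) = p 0 ^ 2 - 1 := by linarith
  have h2 : (∑ i : Fin n, v i.succ * p i.succ) = v 0 * p 0 := by linarith
  rw [h1, h2] at hcs
  rw [h1] at hs'
  -- This is Cauchy–Schwarz for the space parts, with the time components substituted from `lorentz
  -- p p = 1` and `lorentz v p = 0`.
  have h3 : p 0 ^ 2 * (v 0 ^ 2 - ∑ i : Fin n, v i.succ ^ 2) ≤ -∑ i : Fin n, v i.succ ^ 2 := by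
    nlinarith
  refine ⟨by nlinarith, fun h0 => ?_⟩
  have h4 : ∑ i : Fin n, v i.succ ^ 2 = 0 := by
    rw [h0] at h3
    linarith
  have h5 : v 0 = 0 := by nlinarith
  ext i
  refine Fin.cases (by simpa using h5) (fun j => ?_) i
  have := (Finset.sum_eq_zero_iff_of_nonneg (fun i _ => sq_nonneg _)).1 h4 j (Finset.mem_univ _)
  simpa using this

/-- Timelike vectors of the upper half-space pair positively. -/
theorem lorentz_pos {x y : E} (hx : 0 < x 0) (hy : 0 < y 0) (hxx : 0 < lorentz x x)
    (hyy : 0 < lorentz y y) : 0 < lorentz x y := by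
  have hcs := Finset.sum_mul_sq_le_sq_mul_sq Finset.univ
    (fun i : Fin n => x i.succ) (fun i : Fin n => y i.succ)
  have hs : 0 ≤ ∑ i : Fin n, x i.succ ^ 2 := Finset.sum_nonneg fun i _ => sq_nonneg _
  have hs' : 0 ≤ ∑ i : Fin n, y i.succ ^ 2 := Finset.sum_nonneg fun i _ => sq_nonneg _
  simp only [lorentz, ← sq] at *
  have h1 : (∑ i : Fin n, x i.succ * y i.succ) ^ 2 < (x 0 * y 0) ^ 2 := by
    rw [mul_pow]
    have hx2 : 0 < x 0 ^ 2 := by positivity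
    nlinarith
  have := abs_lt_of_sq_lt_sq' h1 (by positivity)
  linarith [this.2]

/-- Reverse Cauchy–Schwarz: `y - lorentz x y • x` is orthogonal to the timelike `x`, hence
spacelike, and its square is `1 - lorentz x y ^ 2`. The sign comes from `lorentz_pos`. -/
theorem one_le_lorentz {x y : E} (hx : 1 ≤ x 0 ∧ lorentz x x = 1)
    (hy : 1 ≤ y 0 ∧ lorentz y y = 1) :
    1 ≤ lorentz x y ∧ (lorentz x y = 1 → x = y) := by
  have h0 : 0 < lorentz x y := lorentz_pos (by linarith [hx.1]) (by linarith [hy.1])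
    (by linarith [hx.2]) (by linarith [hy.2])
  have h1 : lorentz (y + (-lorentz x y) • x) x = 0 := by
    rw [lorentz_add_left, lorentz_smul_left, hx.2, lorentz_comm y]
    ring
  have h2 : lorentz (y + (-lorentz x y) • x) (y + (-lorentz x y) • x) = 1 - lorentz x y ^ 2 := by
    rw [lorentz_add_right, lorentz_smul_right, h1, lorentz_add_left, lorentz_smul_left, hy.2]
    ring
  obtain ⟨h3, h4⟩ := lorentz_self_nonpos hx.2 h1
  rw [h2] at h3 h4
  refine ⟨by nlinarith, fun h => ?_⟩
  have h5 := h4 (by rw [h]; ring)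
  rw [h, neg_one_smul, ← sub_eq_add_neg, sub_eq_zero] at h5
  exact h5.symm

/-- Lorentzian counterpart of Bessel's inequality: the component of `x` orthogonal to `p` and `v` is
spacelike. -/
theorem lorentz_sq_le {p v x : E} (hp : lorentz p p = 1) (hv : lorentz v v = -1)
    (hvp : lorentz v p = 0) (hx : lorentz x x = 1) :
    lorentz v x ^ 2 ≤ lorentz p x ^ 2 - 1 := by
  have h := (lorentz_self_nonpos (v := x + (-lorentz p x) • p + lorentz v x • v) hp (by
    rw [lorentz_add_left, lorentz_add_left, lorentz_smul_left, lorentz_smul_left, hvp, hp,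
      lorentz_comm x]
    ring)).1
  simp only [lorentz_add_left, lorentz_add_right, lorentz_smul_left, lorentz_smul_right, hp, hv,
    hvp, hx, lorentz_comm x p, lorentz_comm x v, lorentz_comm p v] at h
  nlinarith

/-- A combination of a point of the hyperboloid with a unit tangent vector. -/
theorem cosh_smul_add_sinh_smul_mem {p u : E} (hp : 1 ≤ p 0 ∧ lorentz p p = 1)
    (hu : lorentz u u = -1) (hup : lorentz u p = 0) (t : ℝ) :
    1 ≤ (Real.cosh t • p + Real.sinh t • u : E) 0 ∧
      lorentz (Real.cosh t • p + Real.sinh t • u) (Real.cosh t • p + Real.sinh t • u) = 1 := by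
  have h1 : lorentz (Real.cosh t • p + Real.sinh t • u) (Real.cosh t • p + Real.sinh t • u) = 1 := by
    simp only [lorentz_add_left, lorentz_add_right, lorentz_smul_left, lorentz_smul_right, hp.2,
      hu, hup, lorentz_comm p u]
    linarith [Real.cosh_sq t]
  refine ⟨?_, h1⟩
  -- With this bound `cosh t * p 0` dominates `|sinh t * u 0|`, so the geodesic stays on the upper
  -- sheet.
  have h2 : u 0 ^ 2 ≤ p 0 ^ 2 - 1 := by
    have hcs := Finset.sum_mul_sq_le_sq_mul_sq Finset.univ
      (fun i : Fin n => u i.succ) (fun i : Fin n => p i.succ)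
    have hpp := hp.2
    simp only [lorentz, ← sq] at hu hup hpp
    have e1 : (∑ i : Fin n, p i.succ ^ 2) = p 0 ^ 2 - 1 := by linarith
    have e2 : (∑ i : Fin n, u i.succ * p i.succ) = u 0 * p 0 := by linarith
    have e3 : (∑ i : Fin n, u i.succ ^ 2) = u 0 ^ 2 + 1 := by linarith
    rw [e1, e2, e3] at hcs
    linarith
  have h3 : (Real.sinh t * u 0) ^ 2 < (Real.cosh t * p 0) ^ 2 := by
    rw [mul_pow, mul_pow, Real.cosh_sq]
    nlinarith [sq_nonneg (Real.sinh t), hp.1, mul_nonneg (sq_nonneg (Real.sinh t))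
      (sub_nonneg.2 h2)]
  have h4 := (abs_lt_of_sq_lt_sq' h3
    (mul_nonneg (Real.cosh_pos t).le (by linarith [hp.1]))).1
  have h5 : 0 < (Real.cosh t • p + Real.sinh t • u : E) 0 := by
    simp only [PiLp.add_apply, PiLp.smul_apply, smul_eq_mul]
    linarith
  generalize Real.cosh t • p + Real.sinh t • u = y at *
  have hs : 0 ≤ ∑ i : Fin n, y i.succ ^ 2 := Finset.sum_nonneg fun i _ => sq_nonneg _
  simp only [lorentz, ← sq] at h1
  nlinarith

theorem inv_sqrt_smul_mem {Y : E} (h0 : 0 < Y 0) (hY : 0 < lorentz Y Y) :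
    1 ≤ ((√(lorentz Y Y))⁻¹ • Y : E) 0 ∧
      lorentz ((√(lorentz Y Y))⁻¹ • Y) ((√(lorentz Y Y))⁻¹ • Y) = 1 := by
  have h1 : lorentz ((√(lorentz Y Y))⁻¹ • Y) ((√(lorentz Y Y))⁻¹ • Y) = 1 := by
    rw [lorentz_smul_left, lorentz_smul_right]
    have := Real.sqrt_pos.2 hY
    field_simp
    rw [Real.sq_sqrt hY.le]
  refine ⟨?_, h1⟩
  have h2 : 0 < ((√(lorentz Y Y))⁻¹ • Y : E) 0 := by
    have := Real.sqrt_pos.2 hY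
    simp only [PiLp.smul_apply, smul_eq_mul]
    positivity
  generalize (√(lorentz Y Y))⁻¹ • Y = y at *
  have hs : 0 ≤ ∑ i : Fin n, y i.succ ^ 2 := Finset.sum_nonneg fun i _ => sq_nonneg _
  simp only [lorentz, ← sq] at h1
  nlinarith

/-- If `z` is too far from the point at distance `D` from `p` in direction `-v` (with
`cosh D = c`, `sinh D = s`), then every ball of radius `D` containing `p` and `z` contains a
fixed point beyond the hyperplane orthogonal to `v`. -/
theorem exists_lorentz_neg_of_lt_lorentz {p z v : E} (hp : 1 ≤ p 0 ∧ lorentz p p = 1)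
    (hz : 1 ≤ z 0 ∧ lorentz z z = 1) (hv : lorentz v v = -1) (hvp : lorentz v p = 0) {c s : ℝ}
    (hc : 0 < c) (hs : 0 < s) (hcs : c ^ 2 - s ^ 2 = 1)
    (h : c < c * lorentz p z - s * lorentz v z) :
    ∃ y : E, (1 ≤ y 0 ∧ lorentz y y = 1) ∧ lorentz y v < 0 ∧
      ∀ x : E, (1 ≤ x 0 ∧ lorentz x x = 1) → lorentz p x ≤ c → lorentz z x ≤ c →
        lorentz y x ≤ c := by
  have hαβ := lorentz_sq_le hp.2 hv hvp hz.2
  have hα1 := (one_le_lorentz hp hz).1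
  have hα : 1 < lorentz p z := by
    by_contra! h1
    have h2 : lorentz v z ^ 2 ≤ 0 := by nlinarith
    have h3 : lorentz v z = 0 := by nlinarith
    rw [h3] at h
    nlinarith
  obtain ⟨μ, hμ1, hμ2⟩ : ∃ μ, max 0 (lorentz v z) < μ ∧ μ < c * (lorentz p z - 1) / s := by
    refine exists_between (max_lt ?_ ?_)
    · have : 0 < lorentz p z - 1 := by linarith
      positivity
    · rw [lt_div_iff₀ hs]
      linarith
  have hμ0 : 0 < μ := (le_max_left _ _).trans_lt hμ1
  have hμβ : 0 < μ - lorentz v z := by linarith [(le_max_right _ _).trans_lt hμ1]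
  rw [lt_div_iff₀ hs] at hμ2
  set R : ℝ := 2 - 2 * lorentz p z + 2 * μ * lorentz v z - μ ^ 2 with hR
  -- Besides `ε < 1`, the conditions make `Y` timelike, make the final estimate hold to second
  -- order, and keep the time component of `Y` positive.
  obtain ⟨ε, ⟨⟨⟨⟨hε, hε1⟩, hε2⟩, hε3⟩, hε4⟩⟩ := (((((eventually_mem_nhdsWithin (a := (0 : ℝ))
    (s := Set.Ioi 0)).and (eventually_mul_lt_nhdsGT_zero 1 one_pos)).and
    (eventually_mul_lt_nhdsGT_zero (-R) (by linarith : 0 < 2 * (lorentz p z - 1)))).and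
    (eventually_mul_lt_nhdsGT_zero (μ ^ 2 * s ^ 2 - c ^ 2 * R)
      (by nlinarith : 0 < 2 * c * (c * (lorentz p z - 1) - μ * s)))).and
    (eventually_mul_lt_nhdsGT_zero (-(z 0 + μ * v 0 - p 0))
      (by linarith [hp.1] : 0 < p 0))).exists
  have hε : 0 < ε := hε
  set Y : E := (1 - ε) • p + ε • z + (ε * μ) • v with hY
  have hYx : ∀ x, lorentz Y x = (1 - ε) * lorentz p x + ε * lorentz z x + ε * μ * lorentz v x :=
    fun x => by
    rw [hY, lorentz_add_left, lorentz_add_left, lorentz_smul_left, lorentz_smul_left,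
      lorentz_smul_left]
  have hYv : lorentz Y v < 0 := by
    rw [hYx, hv, lorentz_comm p, hvp, lorentz_comm z v]
    nlinarith [mul_pos hε hμβ]
  have hYY : lorentz Y Y = 1 + 2 * ε * (lorentz p z - 1) + ε ^ 2 * R := by
    rw [hYx, lorentz_comm p Y, lorentz_comm z Y,
      lorentz_comm v Y, hYx, hYx, hYx, hp.2, hz.2, hv, hvp, lorentz_comm p v, hvp,
      lorentz_comm z p, lorentz_comm z v, hR]
    ring
  have hY1 : 0 < lorentz Y Y := by
    rw [hYY]
    nlinarith [mul_lt_mul_of_pos_left hε2 hε]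
  have hY0 : 0 < Y 0 := by
    simp only [hY, PiLp.add_apply, PiLp.smul_apply, smul_eq_mul]
    linarith
  have hsq : 0 < √(lorentz Y Y) := Real.sqrt_pos.2 hY1
  have hle : c + ε * (μ * s) ≤ c * √(lorentz Y Y) := by
    refine abs_le_of_sq_le_sq' ?_ (by positivity) |>.2
    rw [mul_pow, Real.sq_sqrt hY1.le, hYY]
    nlinarith [mul_lt_mul_of_pos_left hε3 hε]
  refine ⟨_, inv_sqrt_smul_mem hY0 hY1, ?_, fun x hx hpx hzx => ?_⟩
  · rw [lorentz_smul_left]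
    exact mul_neg_of_pos_of_neg (inv_pos.2 hsq) hYv
  · rw [lorentz_smul_left, inv_mul_eq_div, div_le_iff₀ hsq]
    refine le_trans ?_ hle
    rw [hYx]
    have h1 := lorentz_sq_le hp.2 hv hvp hx.2
    have h3 := (one_le_lorentz hp hx).1
    have h2 : lorentz v x ≤ s := by
      refine (abs_le_of_sq_le_sq' (a := lorentz v x) (b := s) ?_ hs.le).2
      linarith [pow_le_pow_left₀ (by linarith) hpx 2]
    linarith [mul_le_mul_of_nonneg_left hpx (by linarith : 0 ≤ 1 - ε),
      mul_le_mul_of_nonneg_left hzx hε.le, mul_le_mul_of_nonneg_left h2 (mul_pos hε hμ0).le]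

end Lorentz
end SpaceForm

/-! ### Estimates along geodesics and the Euclidean perturbation -/

open Real

/-- For `f t = cos t * A + sin t * B` one has `sin a * f t = sin (a - t) * f 0 + sin t * f a`. The
weights are non-negative with sum at least `sin a`, so a lower bound `c ≥ 0` at both ends persists
in between. This yields convexity of spherical balls. -/
theorem le_cos_mul_add_sin_mul {a t A B c : ℝ} (ha : 0 < a) (ha' : a < π) (ht : 0 ≤ t)
    (hta : t ≤ a) (hc : 0 ≤ c) (hA : c ≤ A) (hB : c ≤ cos a * A + sin a * B) :
    c ≤ cos t * A + sin t * B := by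
  have hs : 0 < sin a := sin_pos_of_pos_of_lt_pi ha ha'
  have h1 : 0 ≤ sin t := sin_nonneg_of_nonneg_of_le_pi ht (by linarith)
  have h2 : 0 ≤ sin (a - t) := sin_nonneg_of_nonneg_of_le_pi (by linarith) (by linarith)
  have h3 : sin a ≤ sin (a - t) + sin t := by
    conv_lhs => rw [← sub_add_cancel a t, sin_add]
    nlinarith [cos_le_one t, cos_le_one (a - t)]
  have h4 : sin a * (cos t * A + sin t * B) =
      sin (a - t) * A + sin t * (cos a * A + sin a * B) := by
    rw [sin_sub]
    ring
  refine le_of_mul_le_mul_left ?_ hs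
  rw [h4]
  nlinarith

/-- Same interpolation with `sinh`; now the weights sum to at most `sinh a`, so upper bounds
persist. -/
theorem cosh_mul_add_sinh_mul_le {a t A B c : ℝ} (ha : 0 < a) (ht : 0 ≤ t)
    (hta : t ≤ a) (hc : 0 ≤ c) (hA : A ≤ c) (hB : cosh a * A + sinh a * B ≤ c) :
    cosh t * A + sinh t * B ≤ c := by
  have hs : 0 < sinh a := sinh_pos_iff.2 ha
  have h1 : 0 ≤ sinh t := sinh_nonneg_iff.2 ht
  have h2 : 0 ≤ sinh (a - t) := sinh_nonneg_iff.2 (by linarith)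
  have h3 : sinh (a - t) + sinh t ≤ sinh a := by
    conv_rhs => rw [← sub_add_cancel a t, sinh_add]
    nlinarith [one_le_cosh t, one_le_cosh (a - t)]
  have h4 : sinh a * (cosh t * A + sinh t * B) =
      sinh (a - t) * A + sinh t * (cosh a * A + sinh a * B) := by
    rw [sinh_sub]
    ring
  refine le_of_mul_le_mul_left ?_ hs
  rw [h4]
  nlinarith

/-- If `z` is too far from `p - D • v`, then every ball of radius `D` containing `p` and `z`
contains a fixed point beyond the hyperplane through `p` orthogonal to `v`. -/
theorem exists_inner_lt_of_lt_dist {E : Type*} [NormedAddCommGroup E] [InnerProductSpace ℝ E]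
    {p z v : E} {D : ℝ} (hD : 0 < D) (hv : ⟪v, v⟫ = 1)
    (h : D < dist (p + D • -v) z) :
    ∃ y : E, ⟪p, v⟫ < ⟪y, v⟫ ∧ ∀ x, dist p x ≤ D → dist z x ≤ D → dist y x ≤ D := by
  have hv1 : ‖v‖ = 1 := by
    rw [real_inner_self_eq_norm_sq] at hv
    nlinarith [norm_nonneg v]
  obtain ⟨w, rfl⟩ : ∃ w, z = p + w := ⟨z - p, by abel⟩
  have h1 : 0 < ‖w‖ ^ 2 + 2 * D * ⟪w, v⟫ := by
    have h2 : D ^ 2 < dist (p + D • -v) (p + w) ^ 2 := by gcongr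
    rw [dist_add_left, dist_eq_norm, norm_sub_sq_real, norm_smul, norm_neg, hv1, smul_neg,
      inner_neg_left, real_inner_smul_left, real_inner_comm, Real.norm_of_nonneg hD.le] at h2
    linarith
  have hA : 0 < ‖w‖ ^ 2 := by
    by_contra! h0
    have : w = 0 := norm_eq_zero.1 (by nlinarith [norm_nonneg w])
    simp [this] at h1
  -- The interval for `μ` is non-empty because `h1`, the squared form of `h`, says `-⟪w, v⟫ < ‖w‖ ^
  -- 2 / (2 * D)`.
  obtain ⟨μ, hμ1, hμ2⟩ : ∃ μ, max 0 (-⟪w, v⟫) < μ ∧ μ < ‖w‖ ^ 2 / (2 * D) := by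
    refine exists_between (max_lt (by positivity) ?_)
    rw [lt_div_iff₀ (by positivity)]
    linarith
  have hμ0 : 0 < μ := (le_max_left _ _).trans_lt hμ1
  have hμβ : 0 < ⟪w, v⟫ + μ := by linarith [(le_max_right _ _).trans_lt hμ1]
  rw [lt_div_iff₀ (by positivity)] at hμ2
  obtain ⟨ε, ⟨hε, hε1⟩, hε2⟩ := (((eventually_mem_nhdsWithin (a := (0 : ℝ))
    (s := Set.Ioi 0)).and (eventually_mul_lt_nhdsGT_zero 1 one_pos)).and
    (eventually_mul_lt_nhdsGT_zero (‖w + μ • v‖ ^ 2)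
      (by linarith : 0 < ‖w‖ ^ 2 - μ * (2 * D)))).exists
  have hε : 0 < ε := hε
  refine ⟨p + ε • (w + μ • v), ?_, fun x hp hz => ?_⟩
  · rw [inner_add_left, real_inner_smul_left, inner_add_left, real_inner_smul_left, hv]
    nlinarith [mul_pos hε hμβ]
  · have hp2 : dist p x ^ 2 ≤ D ^ 2 := by gcongr
    have hz2 : dist (p + w) x ^ 2 ≤ D ^ 2 := by gcongr
    refine abs_le_of_sq_le_sq' ?_ hD.le |>.2
    have e1 : p + ε • (w + μ • v) - x = (p - x) + ε • (w + μ • v) := by abel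
    have e2 : p + w - x = (p - x) + w := by abel
    have h3 : ⟪p - x, v⟫ ≤ D := by
      refine (real_inner_le_norm _ _).trans ?_
      rwa [hv1, mul_one, ← dist_eq_norm]
    rw [dist_eq_norm] at hp2 hz2 ⊢
    rw [e2, norm_add_sq_real] at hz2
    rw [e1, norm_add_sq_real, norm_smul, real_inner_smul_right, inner_add_right,
      real_inner_smul_right, mul_pow, Real.norm_of_nonneg hε.le]
    have := mul_le_mul_of_nonneg_left h3 (mul_pos hε hμ0).le
    have := mul_le_mul_of_nonneg_left hz2 hε.le
    have := mul_le_mul_of_nonneg_left hp2 (by linarith : 0 ≤ 1 - ε)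
    have := mul_lt_mul_of_pos_left hε2 hε
    nlinarith

/-! ### Distances and geodesics in the three models -/

namespace SpaceForm
variable {n : ℕ}

section Spherical

theorem cos_gdist (x y : spherical.Point n) : cos (spherical.gdist x y) = ⟪x.1, y.1⟫ := by
  have h := two_mul_arcsin_half_dist x.2 y.2
  change cos (2 * arcsin (dist x.1 y.1 / 2)) = _
  have hx : ⟪x.1, x.1⟫ = 1 := x.2
  have hy : ⟪y.1, y.1⟫ = 1 := y.2
  have h2 := real_inner_mul_inner_self_le x.1 y.1
  rw [hx, hy, ← sq] at h2
  rw [h, cos_arccos] <;> nlinarith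

theorem gdist_spherical_mem (x y : spherical.Point n) : spherical.gdist x y ∈ Set.Icc 0 π := by
  have h := two_mul_arcsin_half_dist x.2 y.2
  change 2 * arcsin (dist x.1 y.1 / 2) ∈ _
  rw [h]
  exact ⟨arccos_nonneg _, arccos_le_pi _⟩

theorem gdist_le_iff_cos_le {x y : spherical.Point n} {D : ℝ} (h0 : 0 ≤ D) (h1 : D ≤ π) :
    spherical.gdist x y ≤ D ↔ cos D ≤ ⟪x.1, y.1⟫ := by
  rw [← cos_gdist]
  exact (strictAntiOn_cos.le_iff_ge ⟨h0, h1⟩ (gdist_spherical_mem x y)).symm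

theorem gdist_lt_iff_cos_lt {x y : spherical.Point n} {D : ℝ} (h0 : 0 ≤ D) (h1 : D ≤ π) :
    spherical.gdist x y < D ↔ cos D < ⟪x.1, y.1⟫ := by
  rw [← cos_gdist]
  exact (strictAntiOn_cos.lt_iff_gt ⟨h0, h1⟩ (gdist_spherical_mem x y)).symm

theorem inner_geodesic (p u y : spherical.Ambient n) (t : ℝ) :
    ⟪spherical.geodesic p u t, y⟫ = cos t * ⟪p, y⟫ + sin t * ⟪u, y⟫ := by
  change ⟪cos t • p + sin t • u, y⟫ = _
  rw [inner_add_left, real_inner_smul_left, real_inner_smul_left]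

theorem inner_geodesic_geodesic {p u v : spherical.Ambient n} (hp : p ∈ spherical.carrier n)
    (hu : u ∈ spherical.unitTangent p) (hv : v ∈ spherical.unitTangent p) (t s : ℝ) :
    ⟪spherical.geodesic p u t, spherical.geodesic p v s⟫ =
      cos t * cos s + sin t * sin s * ⟪u, v⟫ := by
  have h1 : ⟪p, p⟫ = 1 := hp
  have h2 : ⟪u, p⟫ = 0 := hu.1
  have h3 : ⟪v, p⟫ = 0 := hv.1
  rw [inner_geodesic, real_inner_comm, inner_geodesic, h1, h3, real_inner_comm, inner_geodesic,
    real_inner_comm u p, h2, real_inner_comm u v]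
  ring

end Spherical

section Hyperbolic

theorem one_le_lorentz_point (x y : hyperbolic.Point n) : 1 ≤ lorentz (n := n) x.1 y.1 :=
  (one_le_lorentz x.2 y.2).1

theorem cosh_gdist (x y : hyperbolic.Point n) :
    cosh (hyperbolic.gdist x y) = lorentz (n := n) x.1 y.1 :=
  cosh_arcosh (one_le_lorentz_point x y)

theorem gdist_hyperbolic_nonneg (x y : hyperbolic.Point n) : 0 ≤ hyperbolic.gdist x y :=
  arcosh_nonneg (one_le_lorentz_point x y)

theorem gdist_le_iff_le_cosh {x y : hyperbolic.Point n} {D : ℝ} (h0 : 0 ≤ D) :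
    hyperbolic.gdist x y ≤ D ↔ lorentz (n := n) x.1 y.1 ≤ cosh D := by
  rw [← cosh_gdist]
  exact (cosh_strictMonoOn.le_iff_le (gdist_hyperbolic_nonneg x y) h0).symm

theorem gdist_lt_iff_lt_cosh {x y : hyperbolic.Point n} {D : ℝ} (h0 : 0 ≤ D) :
    hyperbolic.gdist x y < D ↔ lorentz (n := n) x.1 y.1 < cosh D := by
  rw [← cosh_gdist]
  exact (cosh_strictMonoOn.lt_iff_lt (gdist_hyperbolic_nonneg x y) h0).symm

theorem lorentz_geodesic (p u y : EuclideanSpace ℝ (Fin (n + 1))) (t : ℝ) :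
    lorentz (n := n) (hyperbolic.geodesic p u t) y =
      cosh t * lorentz (n := n) p y + sinh t * lorentz (n := n) u y := by
  change lorentz (cosh t • p + sinh t • u) y = _
  rw [lorentz_add_left, lorentz_smul_left, lorentz_smul_left]

theorem lorentz_geodesic_geodesic {p u v : EuclideanSpace ℝ (Fin (n + 1))}
    (hp : p ∈ hyperbolic.carrier n) (hu : u ∈ hyperbolic.unitTangent (n := n) p)
    (hv : v ∈ hyperbolic.unitTangent (n := n) p) (t s : ℝ) :
    lorentz (n := n) (hyperbolic.geodesic p u t) (hyperbolic.geodesic p v s) =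
      cosh t * cosh s + sinh t * sinh s * lorentz (n := n) u v := by
  have h1 : lorentz (n := n) p p = 1 := hp.2
  have h2 : lorentz (n := n) u p = 0 := hu.1
  have h3 : lorentz (n := n) v p = 0 := hv.1
  change lorentz (cosh t • p + sinh t • u) (cosh s • p + sinh s • v) = _
  simp only [lorentz_add_left, lorentz_add_right, lorentz_smul_left, lorentz_smul_right, h1,
    h2, h3, lorentz_comm p v]
  ring

end Hyperbolic

theorem gdist_comm (M : SpaceForm) (x y : M.Point n) : M.gdist x y = M.gdist y x := by
  cases M
  · exact dist_comm _ _
  · exact congrArg (fun t => 2 * arcsin (t / 2)) (dist_comm x.1 y.1)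
  · exact congrArg arcosh (lorentz_comm (n := n) x.1 y.1)

theorem gdist_nonneg (M : SpaceForm) (x y : M.Point n) : 0 ≤ M.gdist x y := by
  cases M
  · exact dist_nonneg
  · exact (gdist_spherical_mem x y).1
  · exact gdist_hyperbolic_nonneg x y

theorem gdist_eq_zero (M : SpaceForm) {x y : M.Point n} : M.gdist x y = 0 ↔ x = y := by
  cases M
  · exact dist_eq_zero.trans Subtype.ext_iff.symm
  · constructor
    · intro h
      have h1 := cos_gdist x y
      rw [h, cos_zero] at h1
      have h2 : ‖x.1 - y.1‖ ^ 2 = 0 := by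
        have hx : ⟪x.1, x.1⟫ = 1 := x.2
        have hy : ⟪y.1, y.1⟫ = 1 := y.2
        rw [norm_sub_sq_real, ← real_inner_self_eq_norm_sq, ← real_inner_self_eq_norm_sq, hx, hy,
          ← h1]
        norm_num
      exact Subtype.ext (sub_eq_zero.1 (norm_eq_zero.1 (pow_eq_zero_iff two_ne_zero |>.1 h2)))
    · rintro rfl
      change 2 * arcsin (dist x.1 x.1 / 2) = 0
      simp
  · constructor
    · intro h
      have h1 := cosh_gdist x y
      rw [h, cosh_zero] at h1
      exact Subtype.ext ((one_le_lorentz x.2 y.2).2 h1.symm)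
    · rintro rfl
      exact (arcosh_eq_zero_iff (one_le_lorentz_point x x)).2 x.2.2

theorem continuous_gdist (M : SpaceForm) :
    Continuous fun xy : M.Point n × M.Point n => M.gdist xy.1 xy.2 := by
  have h : Continuous fun xy : M.Point n × M.Point n => (xy.1.1, xy.2.1) := by fun_prop
  cases M
  · exact continuous_dist.comp h
  · exact continuous_const.mul (continuous_arcsin.comp ((continuous_dist.comp h).div_const 2))
  · exact continuousOn_arcosh.comp_continuous (continuous_lorentz.comp h)
      fun xy => one_le_lorentz_point xy.1 xy.2

theorem continuous_geodesic (M : SpaceForm) (p u : M.Ambient n) : Continuous (M.geodesic p u) := by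
  cases M
  · exact continuous_const.add (continuous_id.smul continuous_const)
  · exact (continuous_cos.smul continuous_const).add (continuous_sin.smul continuous_const)
  · exact (continuous_cosh.smul continuous_const).add (continuous_sinh.smul continuous_const)

theorem geodesic_zero (M : SpaceForm) (p u : M.Ambient n) : M.geodesic p u 0 = p := by
  cases M
  · change p + (0 : ℝ) • u = p
    simp
  · change cos 0 • p + sin 0 • u = p
    simp
  · change cosh 0 • p + sinh 0 • u = p
    simp

theorem neg_mem_unitTangent (M : SpaceForm) {p u : M.Ambient n} (hu : u ∈ M.unitTangent p) :
    -u ∈ M.unitTangent p := by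
  cases M
  · exact ⟨trivial, (inner_neg_neg u u).trans hu.2⟩
  · exact ⟨(inner_neg_left u p).trans (neg_eq_zero.2 hu.1), (inner_neg_neg u u).trans hu.2⟩
  · refine ⟨(lorentz_neg_left (n := n) u p).trans (neg_eq_zero.2 hu.1), ?_⟩
    refine Eq.trans (congrArg Neg.neg ?_) hu.2
    exact (lorentz_neg_left (n := n) u (-u)).trans
      ((congrArg Neg.neg (lorentz_neg_right (n := n) u u)).trans (neg_neg _))

theorem geodesic_mem_carrier (M : SpaceForm) {p u : M.Ambient n} (hp : p ∈ M.carrier n)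
    (hu : u ∈ M.unitTangent p) (t : ℝ) : M.geodesic p u t ∈ M.carrier n := by
  cases M
  · trivial
  · refine (inner_geodesic_geodesic hp hu hu t t).trans ?_
    have h : ⟪u, u⟫ = 1 := hu.2
    rw [h]
    linarith [cos_sq_add_sin_sq t]
  · have h : -lorentz (n := n) u u = 1 := hu.2
    exact cosh_smul_add_sinh_smul_mem hp (neg_eq_iff_eq_neg.1 h) hu.1 t

/-- The point at time `t` on the geodesic through `p` with initial direction `u`. -/
def geodesicPoint (M : SpaceForm) (p : M.Point n) {u : M.Ambient n} (hu : u ∈ M.unitTangent p.1)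
    (t : ℝ) : M.Point n :=
  ⟨M.geodesic p.1 u t, M.geodesic_mem_carrier p.2 hu t⟩

end SpaceForm

/-! ### Balls, half-spaces and first variation -/

namespace SpaceForm
variable {n : ℕ}

theorem gdist_geodesicPoint (M : SpaceForm) (p : M.Point n) {u : M.Ambient n}
    (hu : u ∈ M.unitTangent p.1) {t : ℝ} (ht : 0 ≤ t) (htS : M = spherical → t ≤ π) :
    M.gdist p (M.geodesicPoint p hu t) = t := by
  cases M
  · change dist p.1 (p.1 + t • u) = t
    have h : ⟪u, u⟫ = 1 := hu.2
    rw [real_inner_self_eq_norm_sq] at h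
    have h1 : ‖u‖ = 1 := by nlinarith [norm_nonneg u]
    rw [dist_self_add_right, norm_smul, h1, Real.norm_of_nonneg ht, mul_one]
  · refine injOn_cos (gdist_spherical_mem _ _) ⟨ht, htS rfl⟩ ?_
    rw [cos_gdist]
    have h1 : ⟪p.1, p.1⟫ = 1 := p.2
    have h2 : ⟪u, p.1⟫ = 0 := hu.1
    change ⟪p.1, spherical.geodesic p.1 u t⟫ = _
    rw [real_inner_comm, inner_geodesic, h1, h2]
    ring
  · refine cosh_strictMonoOn.injOn (gdist_hyperbolic_nonneg _ _) ht ?_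
    rw [cosh_gdist]
    have h1 : lorentz (n := n) p.1 p.1 = 1 := p.2.2
    have h2 : lorentz (n := n) u p.1 = 0 := hu.1
    have h3 := lorentz_geodesic (n := n) p.1 u p.1 t
    rw [h1, h2] at h3
    refine (lorentz_comm (n := n) _ _).trans (h3.trans (by ring))

/-- Any two points that are not antipodal are joined by a geodesic. -/
theorem exists_geodesicPoint_eq (M : SpaceForm) {p y : M.Point n} (hpy : p ≠ y)
    (hS : M = spherical → M.gdist p y < π) :
    ∃ (u : M.Ambient n) (hu : u ∈ M.unitTangent p.1), M.geodesicPoint p hu (M.gdist p y) = y := by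
  have h0 : 0 < M.gdist p y :=
    lt_of_le_of_ne (M.gdist_nonneg p y) fun h => hpy (M.gdist_eq_zero.1 h.symm)
  cases M
  · have h0 : 0 < dist p.1 y.1 := h0
    refine ⟨(dist p.1 y.1)⁻¹ • (y.1 - p.1), ⟨trivial, ?_⟩, Subtype.ext ?_⟩
    · change ⟪_, _⟫ = (1 : ℝ)
      rw [real_inner_smul_left, real_inner_smul_right, real_inner_self_eq_norm_sq, ← dist_eq_norm,
        dist_comm y.1]
      field_simp
    · change p.1 + dist p.1 y.1 • ((dist p.1 y.1)⁻¹ • (y.1 - p.1)) = y.1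
      rw [smul_smul, mul_inv_cancel₀ h0.ne', one_smul, add_sub_cancel]
  · have hs := sin_pos_of_pos_of_lt_pi h0 (hS rfl)
    have hc := cos_gdist p y
    generalize spherical.gdist p y = a at *
    have h1 : ⟪p.1, p.1⟫ = 1 := p.2
    have h2 : ⟪y.1, y.1⟫ = 1 := y.2
    refine ⟨(sin a)⁻¹ • (y.1 - cos a • p.1), ⟨?_, ?_⟩, Subtype.ext ?_⟩
    · change ⟪_, _⟫ = (0 : ℝ)
      rw [real_inner_smul_left, inner_sub_left, real_inner_smul_left, real_inner_comm p.1 y.1, h1,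
        hc]
      ring
    · change ⟪_, _⟫ = (1 : ℝ)
      rw [real_inner_smul_left, real_inner_smul_right, inner_sub_left, inner_sub_right,
        inner_sub_right, real_inner_smul_left, real_inner_smul_left, real_inner_smul_right,
        real_inner_smul_right, real_inner_comm p.1 y.1, h1, h2, ← hc]
      field_simp
      linarith [cos_sq_add_sin_sq a]
    · change cos a • p.1 + sin a • ((sin a)⁻¹ • (y.1 - cos a • p.1)) = y.1
      rw [smul_smul, mul_inv_cancel₀ hs.ne', one_smul, add_sub_cancel]
  · have hs := sinh_pos_iff.2 h0
    have hc := cosh_gdist p y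
    generalize hyperbolic.gdist p y = a at *
    obtain ⟨p, hp⟩ := p
    obtain ⟨y, hy⟩ := y
    change EuclideanSpace ℝ (Fin (n + 1)) at p y
    have h1 : lorentz (n := n) p p = 1 := hp.2
    have h2 : lorentz (n := n) y y = 1 := hy.2
    change cosh a = lorentz p y at hc
    let u : EuclideanSpace ℝ (Fin (n + 1)) := (sinh a)⁻¹ • (y + (-cosh a) • p)
    refine ⟨u, ⟨?_, ?_⟩, Subtype.ext ?_⟩
    · change lorentz u p = 0
      simp only [u, lorentz_smul_left, lorentz_add_left, h1, lorentz_comm y p, ← hc]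
      ring
    · change -lorentz u u = 1
      simp only [u, lorentz_smul_left, lorentz_smul_right, lorentz_add_left, lorentz_add_right,
        h1, h2, lorentz_comm y p, ← hc]
      field_simp
      linarith [cosh_sq a]
    · change cosh a • p + sinh a • ((sinh a)⁻¹ • (y + (-cosh a) • p)) = y
      rw [smul_smul, mul_inv_cancel₀ hs.ne', one_smul]
      module

/-- The bound `t < π` matters on the sphere, where the great circle re-enters the half-space at time
`π`. -/
theorem geodesicPoint_notMem_halfSpace (M : SpaceForm) (p : M.Point n) {v : M.Ambient n}
    (hv : v ∈ M.unitTangent p.1) {t : ℝ} (ht : 0 < t) (htS : t < π) :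
    M.geodesicPoint p hv t ∉ M.halfSpace p.1 v := by
  intro h
  cases M
  · change ⟪p.1 + t • v, v⟫ ≤ ⟪p.1, v⟫ at h
    have h1 : ⟪v, v⟫ = 1 := hv.2
    rw [inner_add_left, real_inner_smul_left, h1] at h
    linarith
  · change ⟪spherical.geodesic p.1 v t, v⟫ ≤ 0 at h
    have h1 : ⟪v, v⟫ = 1 := hv.2
    have h2 : ⟪v, p.1⟫ = 0 := hv.1
    rw [inner_geodesic, h1, real_inner_comm, h2] at h
    linarith [sin_pos_of_pos_of_lt_pi ht htS]
  · have h0 := lorentz_geodesic (n := n) p.1 v v t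
    have h : -lorentz (n := n) (hyperbolic.geodesic p.1 v t) v ≤ 0 := h
    have h1 : -lorentz (n := n) v v = 1 := hv.2
    have h2 : lorentz (n := n) v p.1 = 0 := hv.1
    have h3 := (lorentz_comm (n := n) p.1 v).trans h2
    rw [h3, ← neg_eq_iff_eq_neg.2 h1.symm] at h0
    linarith [sinh_pos_iff.2 ht]

/-- Balls are geodesically convex. -/
theorem gdist_geodesicPoint_le (M : SpaceForm) {D : ℝ} (hS : M = spherical → D < π / 2)
    {x y z : M.Point n} (hxy : M.gdist x y ≤ D) (hxz : M.gdist x z ≤ D) {a : ℝ} (ha : a ≤ D)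
    {u : M.Ambient n} (hu : u ∈ M.unitTangent y.1) (hz : M.geodesicPoint y hu a = z)
    {t : ℝ} (ht : 0 ≤ t) (hta : t ≤ a) : M.gdist x (M.geodesicPoint y hu t) ≤ D := by
  subst hz
  obtain rfl | ha0 : t = a ∨ 0 < a := by
    rcases hta.eq_or_lt with h | h
    · exact Or.inl h
    · exact Or.inr (by linarith)
  · exact hxz
  have hD : 0 ≤ D := by linarith
  rw [gdist_comm] at hxy hxz ⊢
  cases M
  · change dist (y.1 + t • u) x.1 ≤ D
    have h1 : dist (y.1 + (a : ℝ) • u) x.1 ≤ D := hxz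
    have h2 : dist y.1 x.1 ≤ D := hxy
    have h := (convex_closedBall x.1 D) h2 h1 (a := 1 - t / a) (b := t / a)
      (by rw [sub_nonneg, div_le_one ha0]; exact hta) (by positivity) (by ring)
    have e : (1 - t / a) • y.1 + (t / a) • (y.1 + a • u) = y.1 + t • u := by
      rw [smul_add, ← add_assoc, ← add_smul, smul_smul, div_mul_cancel₀ _ ha0.ne',
        sub_add_cancel, one_smul]
    rw [e] at h
    exact h
  · have hD' := hS rfl
    rw [gdist_le_iff_cos_le hD (by linarith [pi_pos])] at hxy hxz ⊢
    have hxz : cos D ≤ ⟪spherical.geodesic y.1 u a, x.1⟫ := hxz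
    change cos D ≤ ⟪spherical.geodesic y.1 u t, x.1⟫
    rw [inner_geodesic] at hxz ⊢
    exact le_cos_mul_add_sin_mul ha0 (by linarith) ht hta
      (cos_nonneg_of_mem_Icc ⟨by linarith, hD'.le⟩) hxy hxz
  · rw [gdist_le_iff_le_cosh hD] at hxy hxz ⊢
    have h1 := lorentz_geodesic (n := n) y.1 u x.1 a
    have h2 := lorentz_geodesic (n := n) y.1 u x.1 t
    exact h2.le.trans (cosh_mul_add_sinh_mul_le ha0 ht hta (cosh_pos D).le hxy (h1.ge.trans hxz))

/-- Intersections of two balls of radius `D` with different centres lie in a smaller ball around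
the midpoint of the centres. -/
theorem exists_forall_gdist_lt (M : SpaceForm) {D : ℝ} (hD : 0 < D)
    (hS : M = spherical → D < π / 2) {p q : M.Point n} (hpq : p ≠ q) (h : M.gdist p q ≤ D) :
    ∃ m : M.Point n, ∀ x, M.gdist p x ≤ D → M.gdist q x ≤ D → M.gdist m x < D := by
  have h0 : 0 < M.gdist p q :=
    lt_of_le_of_ne (M.gdist_nonneg p q) fun h => hpq (M.gdist_eq_zero.1 h.symm)
  cases M
  · refine ⟨⟨midpoint ℝ p.1 q.1, trivial⟩, fun x hp hq => ?_⟩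
    have hp : dist p.1 x.1 ≤ D := hp
    have hq : dist q.1 x.1 ≤ D := hq
    have h0 : 0 < dist p.1 q.1 := h0
    change dist (midpoint ℝ p.1 q.1) x.1 < D
    -- Apollonius' identity: passing to the midpoint gains `(dist p q / 2) ^ 2` in squared distance.
    have h1 := EuclideanGeometry.dist_sq_add_dist_sq_eq_two_mul_dist_midpoint_sq_add_half_dist_sq
      x.1 p.1 q.1
    rw [dist_comm x.1, dist_comm x.1, dist_comm x.1] at h1
    refine lt_of_pow_lt_pow_left₀ 2 hD.le ?_
    have h2 : dist p.1 x.1 ^ 2 ≤ D ^ 2 := by gcongr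
    have h3 : dist q.1 x.1 ^ 2 ≤ D ^ 2 := by gcongr
    have h4 : 0 < (dist p.1 q.1 / 2) ^ 2 := by positivity
    linarith
  · have hD' := hS rfl
    have hDπ : D ≤ π := by linarith [pi_pos]
    have hc : 0 < cos D := cos_pos_of_mem_Ioo ⟨by linarith, hD'⟩
    rw [gdist_le_iff_cos_le hD.le hDπ] at h
    have h1 : ⟪p.1, p.1⟫ = 1 := p.2
    have h2 : ⟪q.1, q.1⟫ = 1 := q.2
    have h3 : ⟪p.1, q.1⟫ < 1 := by
      rw [← cos_gdist, ← cos_zero]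
      exact strictAntiOn_cos ⟨le_rfl, pi_pos.le⟩ (gdist_spherical_mem p q) h0
    have h4 : ‖p.1 + q.1‖ ^ 2 = 2 + 2 * ⟪p.1, q.1⟫ := by
      rw [norm_add_sq_real, ← real_inner_self_eq_norm_sq, ← real_inner_self_eq_norm_sq, h1, h2]
      ring
    have h5 : 0 < ‖p.1 + q.1‖ := by
      refine lt_of_le_of_ne (norm_nonneg _) fun h => ?_
      rw [← h] at h4
      linarith
    -- Strictness arises here: `⟪p + q, x⟫ ≥ 2 * cos D` is divided by a norm less than `2`, and `cos
    -- D > 0`. In the hyperbolic case the divisor exceeds `2` and the inequalities are reversed.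
    have h6 : ‖p.1 + q.1‖ < 2 := by nlinarith
    refine ⟨⟨‖p.1 + q.1‖⁻¹ • (p.1 + q.1), ?_⟩, fun x hp hq => ?_⟩
    · change ⟪_, _⟫ = (1 : ℝ)
      rw [real_inner_smul_left, real_inner_smul_right, real_inner_self_eq_norm_sq]
      field_simp
    · rw [gdist_le_iff_cos_le hD.le hDπ] at hp hq
      rw [gdist_lt_iff_cos_lt hD.le hDπ]
      change cos D < ⟪‖p.1 + q.1‖⁻¹ • (p.1 + q.1), x.1⟫
      rw [real_inner_smul_left, inner_add_left, inv_mul_eq_div, lt_div_iff₀ h5]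
      nlinarith
  · have hc := cosh_pos D
    have h3 : 1 < lorentz (n := n) p.1 q.1 := by
      rw [← cosh_gdist]
      exact one_lt_cosh.2 h0.ne'
    obtain ⟨p, hp⟩ := p
    obtain ⟨q, hq⟩ := q
    change EuclideanSpace ℝ (Fin (n + 1)) at p q
    have h1 : lorentz (n := n) p p = 1 := hp.2
    have h2 : lorentz (n := n) q q = 1 := hq.2
    have h1' : 1 ≤ p 0 := hp.1
    have h2' : 1 ≤ q 0 := hq.1
    change 1 < lorentz p q at h3
    have h4 : lorentz (p + q) (p + q) = 2 + 2 * lorentz p q := by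
      rw [lorentz_add_left, lorentz_add_right, lorentz_add_right, h1, h2, lorentz_comm q p]
      ring
    have h5 : 0 < lorentz (p + q) (p + q) := by linarith
    have h6 : 2 < √(lorentz (p + q) (p + q)) := by
      rw [lt_sqrt (by norm_num)]
      linarith
    refine ⟨⟨(√(lorentz (p + q) (p + q)))⁻¹ • (p + q), inv_sqrt_smul_mem ?_ h5⟩,
      fun x hp hq => ?_⟩
    · rw [PiLp.add_apply]
      linarith
    · rw [gdist_le_iff_le_cosh hD.le] at hp hq
      rw [gdist_lt_iff_lt_cosh hD.le]
      obtain ⟨x, hx⟩ := x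
      change EuclideanSpace ℝ (Fin (n + 1)) at x
      change lorentz p x ≤ _ at hp
      change lorentz q x ≤ _ at hq
      change lorentz ((√(lorentz (p + q) (p + q)))⁻¹ • (p + q)) x < _
      rw [lorentz_smul_left, inv_mul_eq_div, div_lt_iff₀ (by linarith), lorentz_add_left p q x]
      nlinarith

/-- If `K` contains all points at distance at most `D` from `K`, and `v` is an outer normal of `K`
at `p`, then `K` lies in the ball of radius `D` that touches the supporting hyperplane at `p`. -/
theorem gdist_geodesicPoint_neg_le (M : SpaceForm) {D : ℝ} (hD : 0 < D)
    (hS : M = spherical → D < π / 2) {K : Set (M.Point n)}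
    (hK : ∀ y, (∀ x ∈ K, M.gdist y x ≤ D) → y ∈ K) (hdiam : ∀ x ∈ K, ∀ y ∈ K, M.gdist x y ≤ D)
    {p z : M.Point n} (hp : p ∈ K) (hz : z ∈ K) {v : M.Ambient n} (hv : v ∈ M.unitTangent p.1)
    (hKv : K ⊆ M.halfSpace p.1 v) :
    M.gdist (M.geodesicPoint p (M.neg_mem_unitTangent hv) D) z ≤ D := by
  by_contra! h
  cases M
  · obtain ⟨y, hy1, hy2⟩ := exists_inner_lt_of_lt_dist hD hv.2 h
    have := hKv (hK ⟨y, trivial⟩ fun x hx => hy2 x.1 (hdiam p hp x hx) (hdiam z hz x hx))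
    exact (not_le.2 hy1) this
  · have hD' := hS rfl
    have hDπ : D ≤ π := by linarith [pi_pos]
    rw [← not_le, gdist_le_iff_cos_le hD.le hDπ, not_le] at h
    have h : ⟪spherical.geodesic p.1 (-v) D, z.1⟫ < cos D := h
    rw [inner_geodesic, inner_neg_left, mul_neg, ← sub_eq_add_neg] at h
    obtain ⟨y, hy, hyv, hyK⟩ := exists_inner_pos_of_inner_lt p.2 z.2 hv.2 hv.1
      (cos_pos_of_mem_Ioo ⟨by linarith, hD'⟩)
      (sin_pos_of_pos_of_lt_pi hD (by linarith [pi_pos])) (cos_sq_add_sin_sq D) h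
    have := hKv (hK ⟨y, hy⟩ fun x hx => by
      have h1 := hdiam p hp x hx
      have h2 := hdiam z hz x hx
      rw [gdist_le_iff_cos_le hD.le hDπ] at h1 h2 ⊢
      exact hyK x.1 x.2 h1 h2)
    exact (not_le.2 hyv) this
  · rw [← not_le, gdist_le_iff_le_cosh hD.le, not_le] at h
    have h0 := lorentz_geodesic (n := n) p.1 (-v) z.1 D
    have h1 : lorentz (n := n) (-v) z.1 = -lorentz (n := n) v z.1 :=
      lorentz_neg_left (n := n) v z.1
    have h2 := h.trans_eq h0
    rw [h1, mul_neg, ← sub_eq_add_neg] at h2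
    obtain ⟨y, hy, hyv, hyK⟩ := exists_lorentz_neg_of_lt_lorentz p.2 z.2
      (neg_eq_iff_eq_neg.1 hv.2) hv.1 (cosh_pos D) (sinh_pos_iff.2 hD)
      (by rw [cosh_sq]; ring) h2
    have := hKv (hK ⟨y, hy⟩ fun x hx => by
      have h1 := hdiam p hp x hx
      have h2 := hdiam z hz x hx
      rw [gdist_le_iff_le_cosh hD.le] at h1 h2 ⊢
      exact hyK x.1 x.2 h1 h2)
    have : -lorentz (n := n) y v ≤ 0 := this
    linarith

/-- First variation: a point `z` joined to the foot point `p` of `y` by a geodesic that does not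
approach `y` lies behind the hyperplane through `p` orthogonal to the direction of `y`. -/
theorem geodesicPoint_mem_halfSpace (M : SpaceForm) {a b : ℝ} (ha : 0 < a) (hb : 0 < b)
    (haS : M = spherical → a < π) (hbS : M = spherical → b < π) (p : M.Point n)
    {u v : M.Ambient n} (hu : u ∈ M.unitTangent p.1) (hv : v ∈ M.unitTangent p.1)
    (h : ∀ t ∈ Set.Icc 0 b, a ≤ M.gdist (M.geodesicPoint p hv a) (M.geodesicPoint p hu t)) :
    M.geodesicPoint p hu b ∈ M.halfSpace p.1 v := by
  cases M
  · have h1 : ⟪u, u⟫ = 1 := hu.2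
    have h2 : ⟪v, v⟫ = 1 := hv.2
    -- The function is `a ^ 2 - d ^ 2`, with `d` the distance from `y` to the moving point; the
    -- other models use `cos d` and `-cosh d`. Each decreases in `d`, so it is maximal at `t = 0`
    -- and its derivative there gives the sign of the angle.
    have hf : HasDerivAt (fun t : ℝ => 2 * a * ⟪v, u⟫ * t - t ^ 2) (2 * a * ⟪v, u⟫) 0 := by
      exact (((hasDerivAt_id (0 : ℝ)).const_mul (2 * a * ⟪v, u⟫)).sub
        (hasDerivAt_pow 2 (0 : ℝ))).congr_deriv (by simp)
    have h3 := hf.nonpos_of_forall_Icc_le hb fun t ht => by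
      have h4 : a ≤ dist (p.1 + a • v) (p.1 + t • u) := h t ht
      have h5 : a ^ 2 ≤ dist (p.1 + a • v) (p.1 + t • u) ^ 2 := by gcongr
      rw [dist_add_left, dist_eq_norm, norm_sub_sq_real, ← real_inner_self_eq_norm_sq,
        ← real_inner_self_eq_norm_sq] at h5
      simp only [real_inner_smul_left, real_inner_smul_right, h1, h2] at h5
      nlinarith
    have h6 : ⟪v, u⟫ ≤ 0 := by
      by_contra! h7
      have : 0 < 2 * a * ⟪v, u⟫ := by positivity
      linarith
    change ⟪p.1 + b • u, v⟫ ≤ ⟪p.1, v⟫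
    rw [inner_add_left, real_inner_smul_left, real_inner_comm v u]
    nlinarith
  · have hsa := sin_pos_of_pos_of_lt_pi ha (haS rfl)
    have hsb := sin_pos_of_pos_of_lt_pi hb (hbS rfl)
    have hf : HasDerivAt (fun t : ℝ => cos a * cos t + sin a * sin t * ⟪v, u⟫)
        (sin a * ⟪v, u⟫) 0 := by
      exact (((hasDerivAt_cos 0).const_mul (cos a)).add
        (((hasDerivAt_sin 0).const_mul (sin a)).mul_const ⟪v, u⟫)).congr_deriv (by simp)
    have h3 := hf.nonpos_of_forall_Icc_le hb fun t ht => by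
      have h4 := strictAntiOn_cos.antitoneOn ⟨ha.le, (haS rfl).le⟩ (gdist_spherical_mem _ _)
        (h t ht)
      rw [cos_gdist] at h4
      have h5 := (inner_geodesic_geodesic p.2 hv hu a t).ge.trans h4
      simpa using h5
    have h6 : ⟪v, u⟫ ≤ 0 := by
      by_contra! h7
      have : 0 < sin a * ⟪v, u⟫ := by positivity
      linarith
    change ⟪spherical.geodesic p.1 u b, v⟫ ≤ 0
    have h2 : ⟪v, p.1⟫ = 0 := hv.1
    rw [inner_geodesic, real_inner_comm, h2, real_inner_comm]
    nlinarith
  · have hsa := sinh_pos_iff.2 ha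
    have hsb := sinh_pos_iff.2 hb
    have hf : HasDerivAt (fun t : ℝ => -(cosh a * cosh t + sinh a * sinh t * lorentz (n := n) v u))
        (-(sinh a * lorentz (n := n) v u)) 0 := by
      exact (((hasDerivAt_cosh 0).const_mul (cosh a)).add
        (((hasDerivAt_sinh 0).const_mul (sinh a)).mul_const (lorentz (n := n) v u))).neg.congr_deriv
          (by simp)
    have h3 := hf.nonpos_of_forall_Icc_le hb fun t ht => by
      have h4 := cosh_strictMonoOn.monotoneOn ha.le (gdist_hyperbolic_nonneg _ _) (h t ht)
      rw [cosh_gdist] at h4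
      have h5 := h4.trans (lorentz_geodesic_geodesic p.2 hv hu a t).le
      simpa using h5
    have h6 : 0 ≤ lorentz (n := n) v u := by
      by_contra! h7
      nlinarith
    have h7 := lorentz_geodesic (n := n) p.1 u v b
    have h8 : lorentz (n := n) p.1 v = 0 := (lorentz_comm (n := n) _ _).trans hv.1
    have h9 : lorentz (n := n) u v = lorentz (n := n) v u := lorentz_comm (n := n) _ _
    rw [h8, h9] at h7
    change -lorentz (n := n) (hyperbolic.geodesic p.1 u b) v ≤ 0
    nlinarith

/-- The two points lie on one geodesic on opposite sides of `p`, so their distance is `a + D`; on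
the sphere this uses `a + D < π`. -/
theorem lt_gdist_geodesicPoint_neg (M : SpaceForm) {a D : ℝ} (ha : 0 < a) (haD : a ≤ D)
    (hS : M = spherical → D < π / 2) (p : M.Point n) {v : M.Ambient n}
    (hv : v ∈ M.unitTangent p.1) :
    D < M.gdist (M.geodesicPoint p hv a) (M.geodesicPoint p (M.neg_mem_unitTangent hv) D) := by
  have hD : 0 ≤ D := by linarith
  have hv' := M.neg_mem_unitTangent hv
  cases M
  · change D < dist (p.1 + a • v) (p.1 + D • -v)
    have h : ⟪v, v⟫ = 1 := hv.2
    rw [real_inner_self_eq_norm_sq] at h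
    have h1 : ‖v‖ = 1 := by nlinarith [norm_nonneg v]
    rw [dist_add_left, dist_eq_norm, smul_neg, sub_neg_eq_add, ← add_smul, norm_smul, h1, mul_one,
      Real.norm_of_nonneg (by linarith)]
    linarith
  · have hD' := hS rfl
    rw [← not_le, gdist_le_iff_cos_le hD (by linarith [pi_pos]), not_le]
    refine (inner_geodesic_geodesic p.2 hv hv' a D).trans_lt ?_
    have h : ⟪v, v⟫ = 1 := hv.2
    rw [inner_neg_right, h, mul_neg, mul_one, ← sub_eq_add_neg, ← cos_add]
    exact strictAntiOn_cos ⟨hD, by linarith [pi_pos]⟩ ⟨by linarith, by linarith⟩ (by linarith)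
  · rw [← not_le, gdist_le_iff_le_cosh hD, not_le]
    refine lt_of_lt_of_eq ?_ (lorentz_geodesic_geodesic p.2 hv hv' a D).symm
    have h : -lorentz (n := n) v v = 1 := hv.2
    have h1 : lorentz (n := n) v (-v) = -lorentz (n := n) v v := lorentz_neg_right (n := n) v v
    rw [h1, h, mul_one, ← cosh_add]
    exact cosh_strictMonoOn hD (by simp only [Set.mem_Ici]; linarith) (by linarith)

end SpaceForm

/-! ### Constant width and intersections of balls -/

namespace SpaceForm
variable {n : ℕ}

theorem mem_halfSpace_self (M : SpaceForm) (p : M.Point n) {v : M.Ambient n}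
    (hv : v ∈ M.unitTangent p.1) : p ∈ M.halfSpace p.1 v := by
  cases M
  · exact le_refl ⟪p.1, v⟫
  · exact ((real_inner_comm v p.1).trans hv.1).le
  · exact (neg_eq_zero.2 ((lorentz_comm (n := n) p.1 v).trans hv.1)).le

theorem mem_iInter_ball (M : SpaceForm) {K : Set (M.Point n)} {D : ℝ} {y : M.Point n} :
    y ∈ ⋂ x ∈ K, M.ball x D ↔ ∀ x ∈ K, M.gdist y x ≤ D :=
  Set.mem_iInter₂

theorem diam_le_iff (M : SpaceForm) {K : Set (M.Point n)} {D : ℝ} (hD : 0 ≤ D) :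
    M.diam K ≤ ENNReal.ofReal D ↔ ∀ x ∈ K, ∀ y ∈ K, M.gdist x y ≤ D := by
  simp only [diam, iSup₂_le_iff, ENNReal.ofReal_le_ofReal_iff hD]

/-- The geodesic leaving `p` along `v` exits the half-space, hence `K`, at once, so `p` is not
interior. -/
theorem mem_frontier_of_isOuterUnitNormal (M : SpaceForm) {K : Set (M.Point n)} {p : M.Point n}
    {v : M.Ambient n} (hp : p ∈ K) (hv : M.IsOuterUnitNormal K p v) : p ∈ frontier K := by
  refine ⟨subset_closure hp, fun hi => ?_⟩
  have hc : Continuous (M.geodesicPoint p hv.1) :=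
    (M.continuous_geodesic p.1 v).subtype_mk _
  have h0 : M.geodesicPoint p hv.1 0 = p := Subtype.ext (M.geodesic_zero p.1 v)
  have h1 : ∀ᶠ t in 𝓝 (0 : ℝ), M.geodesicPoint p hv.1 t ∈ interior K :=
    hc.continuousAt.eventually_mem (by rw [h0]; exact isOpen_interior.mem_nhds hi)
  obtain ⟨t, ht, ht0, htπ⟩ :=
    ((h1.filter_mono nhdsWithin_le_nhds).and (Ioo_mem_nhdsGT pi_pos)).exists
  exact M.geodesicPoint_notMem_halfSpace p hv.1 ht0 htπ (hv.2 (interior_subset ht))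

theorem IsConstantWidth.mem_of_forall_gdist_le {M : SpaceForm} {K : Set (M.Point n)} {D : ℝ}
    (h : M.IsConstantWidth K D) (hD : 0 < D) (hS : M = spherical → D < π / 2)
    (hne : K.Nonempty) {y : M.Point n} (hy : ∀ x ∈ K, M.gdist y x ≤ D) : y ∈ K := by
  obtain ⟨⟨hK, hconv, -⟩, hdiam, hwidth⟩ := h
  have hle := (M.diam_le_iff hD.le).1 hdiam.le
  by_contra hyK
  obtain ⟨p, hp, hmin⟩ := hK.exists_isMinOn hne (f := fun x => M.gdist y x)
    (M.continuous_gdist.comp (by fun_prop : Continuous fun x => (y, x))).continuousOn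
  have hlt : ∀ {r}, r ≤ D → M = spherical → r < π := fun hr hM => by
    linarith [hS hM, pi_pos]
  have hpos : ∀ {x z : M.Point n}, x ≠ z → 0 < M.gdist x z := fun {x z} hxz =>
    lt_of_le_of_ne (M.gdist_nonneg x z) fun h => hxz (M.gdist_eq_zero.1 h.symm)
  have hpy : p ≠ y := fun h => hyK (h ▸ hp)
  have ha0 := hpos hpy
  have haD : M.gdist p y ≤ D := by
    rw [gdist_comm]
    exact hy p hp
  obtain ⟨v, hv, hvy⟩ := M.exists_geodesicPoint_eq hpy (hlt haD)
  -- By convexity the segment from `p` to any `z ∈ K` stays in `K`, so none of its points is nearer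
  -- to `y` than `p`; first variation applies.
  have hnormal : M.IsOuterUnitNormal K p v := by
    refine ⟨hv, fun z hz => ?_⟩
    by_cases hpz : p = z
    · exact hpz ▸ M.mem_halfSpace_self p hv
    have hbD := hle p hp z hz
    obtain ⟨u, hu, huz⟩ := M.exists_geodesicPoint_eq hpz (hlt hbD)
    rw [← huz]
    refine M.geodesicPoint_mem_halfSpace ha0 (hpos hpz) (hlt haD) (hlt hbD) p hu hv
      fun t ht => ?_
    obtain ⟨w, hw, hwt⟩ := hconv.2 p hp z hz u hu (congrArg Subtype.val huz) ⟨t, ht, rfl⟩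
    have : M.geodesicPoint p hu t = w := Subtype.ext hwt.symm
    rw [hvy, this, gdist_comm M p y]
    exact hmin hw
  obtain ⟨q, hq, hqD⟩ := hwidth p (M.mem_frontier_of_isOuterUnitNormal hp hnormal) v hnormal
    ⟨D, ⟨hD.le, le_rfl⟩, rfl⟩
  have hqD : M.geodesicPoint p (M.neg_mem_unitTangent hv) D = q := Subtype.ext hqD.symm
  have h1 := M.lt_gdist_geodesicPoint_neg ha0 haD hS p hv
  rw [hvy, hqD] at h1
  exact absurd (hy q hq) (not_le.2 h1)

theorem isConstantWidth_of_forall_mem {M : SpaceForm} {K : Set (M.Point n)} {D : ℝ}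
    (hK : IsCompact K) (hD : 0 < D) (hS : M = spherical → D < π / 2)
    (hdiam : M.diam K = ENNReal.ofReal D) (hmem : ∀ y, (∀ x ∈ K, M.gdist y x ≤ D) → y ∈ K) :
    M.IsConstantWidth K D := by
  have hle := (M.diam_le_iff hD.le).1 hdiam.le
  obtain ⟨p, hp, q, hq, hpq⟩ : K.Nontrivial := by
    by_contra h
    rw [Set.not_nontrivial_iff] at h
    have h1 : M.diam K ≤ ENNReal.ofReal 0 :=
      (M.diam_le_iff le_rfl).2 fun x hx y hy => (M.gdist_eq_zero.2 (h hx hy)).le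
    rw [hdiam, ENNReal.ofReal_le_ofReal_iff le_rfl] at h1
    linarith
  -- Each ball of radius `D` about a point of `K` contains both end points, hence the segment, and
  -- `hmem` returns the segment to `K`.
  have hseg : ∀ x ∈ K, ∀ {u : M.Ambient n} (hu : u ∈ M.unitTangent x.1) {a : ℝ}, a ≤ D →
      M.geodesicPoint x hu a ∈ K → M.segmentAlong x.1 u a ⊆ Subtype.val '' K := by
    rintro x hx u hu a ha hz _ ⟨t, ht, rfl⟩
    refine ⟨M.geodesicPoint x hu t, hmem _ fun w hw => ?_, rfl⟩
    rw [gdist_comm]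
    exact M.gdist_geodesicPoint_le hS (hle w hw x hx) (hle w hw _ hz) ha hu rfl ht.1 ht.2
  refine ⟨⟨hK, ⟨?_, fun x hx y hy u hu hxy => ?_⟩, ?_⟩, hdiam, fun p hp v hv => ?_⟩
  · rintro rfl
    -- Any point of `K` can serve as the pole of the hemisphere, as `D < π / 2`.
    refine ⟨p.1, p.2, fun x hx => ?_⟩
    rw [← cos_gdist]
    exact cos_pos_of_mem_Ioo ⟨by linarith [spherical.gdist_nonneg x p, pi_pos],
      (hle x hx p hp).trans_lt (hS rfl)⟩
  · refine hseg x hx hu (hle x hx y hy) ?_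
    have : M.geodesicPoint x hu (M.gdist x y) = y := Subtype.ext hxy
    rwa [this]
  · obtain ⟨m, hm⟩ := M.exists_forall_gdist_lt hD hS hpq (hle p hp q hq)
    refine ⟨m, mem_interior_iff_mem_nhds.2 ?_⟩
    -- Compactness of `K` makes the strict bound at `m` persist, uniformly in `x ∈ K`, for all
    -- centres near `m`.
    have h := hK.eventually_forall_of_forall_eventually (x₀ := m)
      (P := fun y x => M.gdist y x < D) fun x hx =>
        M.continuous_gdist.continuousAt.eventually_lt continuousAt_const
          (hm x (hle p hp x hx) (hle q hq x hx))
    filter_upwards [h] with y hy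
    exact hmem y fun x hx => (hy x hx).le
  · have hp : p ∈ K := hK.isClosed.frontier_subset hp
    exact hseg p hp (M.neg_mem_unitTangent hv.1) le_rfl (hmem _ fun z hz =>
      M.gdist_geodesicPoint_neg_le hD hS hmem hle hp hz hv.1 hv.2)

end SpaceForm
end

theorem proposition4p3 (M : SpaceForm) (n : ℕ) (hn : 2 ≤ n) (K : Set (M.Point n))
    (hK : IsCompact K) (D : ℝ) (hD : 0 < D)
    (hS : M = SpaceForm.spherical → D < Real.pi / 2)
    (hdiam : M.diam K = ENNReal.ofReal D) :
    List.TFAE [M.IsConstantWidth K D,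
      M.IsDiamComplete K,
      K = ⋂ x ∈ K, M.ball x D] := by
  have hle := (M.diam_le_iff hD.le).1 hdiam.le
  have hiff : K = ⋂ x ∈ K, M.ball x D ↔ ∀ y, (∀ x ∈ K, M.gdist y x ≤ D) → y ∈ K := by
    refine ⟨fun h y hy => h ▸ M.mem_iInter_ball.2 hy, fun h => ?_⟩
    exact Set.Subset.antisymm (fun y hy => M.mem_iInter_ball.2 (hle y hy))
      fun y hy => h y (M.mem_iInter_ball.1 hy)
  have hne : K.Nonempty := by
    rw [Set.nonempty_iff_ne_empty]
    rintro rfl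
    have : M.diam (∅ : Set (M.Point n)) = 0 := by simp [SpaceForm.diam]
    rw [this, eq_comm, ENNReal.ofReal_eq_zero] at hdiam
    linarith
  tfae_have 1 → 3 := fun h => hiff.2 fun y hy => h.mem_of_forall_gdist_le hD hS hne hy
  tfae_have 3 → 1 := fun h =>
    SpaceForm.isConstantWidth_of_forall_mem hK hD hS hdiam (hiff.1 h)
  tfae_have 2 → 3 := by
    refine fun h => hiff.2 fun y hy => ?_
    by_contra hyK
    -- A point within `D` of all of `K` could be added without raising the diameter, contrary to
    -- completeness.
    refine (h y hyK).not_ge ?_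
    rw [hdiam, M.diam_le_iff hD.le]
    rintro x (hx | rfl) z (hz | rfl)
    · exact hle x hx z hz
    · exact (M.gdist_comm x z).trans_le (hy x hx)
    · exact hy z hz
    · exact (M.gdist_eq_zero.2 rfl).trans_le hD.le
  tfae_have 3 → 2 := by
    intro h y hyK
    rw [← not_le, hdiam, M.diam_le_iff hD.le]
    exact fun h1 => hyK (hiff.1 h y fun x hx => h1 y (Or.inr rfl) x (Or.inl hx))
  tfae_finish
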